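/- Theorem (Convergence in mean). \label{theorem: convergence in mean} **Model.** Let $\Omega\subseteq\mathbb R$ be a measurable sample space, $\Theta\subset\mathbb R$ a compact interval, and $\rho$ a $\sigma$-finite reference measure concentrated on $\Omega$. Let $\mathcal P$ be a class of probability measures $\mathbb P_{j,\theta}$ ($j\in J$, $\theta\in\Theta$) with densities $\pi_j(x\mid\theta)$ with respect to $\rho$, parameterized by their means: $\int x\,d\mathbb P_{j,\theta}=\theta$. (The index $j$ allows arms with different likelihood functions.) Assume: 1. $\pi_j(x\mid\theta)>0$ for all $j$, $x\in\Omega$, $\theta\in\Theta$ (common support); $\theta\mapsto\pi_j(x\mid\theta)$ is differentiable and $\theta\mapsto\log\pi_j(x\mid\theta)$ is twice differentiable on $\Theta$ (one-sided derivatives at the end points) for $x\in\Omega$. 2. There is $\sigma>0$ with $\partial_\theta^2\log\pi_j(x\mid\theta)\le-\sigma^2$ for all $j$, $x\in\Omega$, $\theta\in\Theta$. 3. There is $c>0$ with $|\partial_\theta\log\pi_j(x\mid\theta)-\partial_\theta\log\pi_j(y\mid\theta)|\le c|x-y|$ for all $j$, $x,y\in\Omega$, $\theta\in\Theta$. 4.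 $\mathbb E_{\mathbb P_{j,\theta_0}}\big[|\log\tfrac{\pi_j(X\mid\theta)}{\pi_j(X\mid\theta')}|^2\big]<\infty$ for all $j$ and $\theta_0,\theta,\theta'\in\Theta$. 5. ($L^1$ transportation inequality) There is $c'>0$ with $W_1(\mathbb P,\mathbb Q)\le\sqrt{2c'D_{\sf KL}(\mathbb Q\|\mathbb P)}$ for every $\mathbb P\in\mathcal P$ and every probability measure $\mathbb Q$ on $\mathbb R$. For a measure $\mathbb P$ and $x\in\mathbb R$ put $d_{\sf U}(\mathbb P,x)=\inf\{D_{\sf KL}(\mathbb P\|\mathbb Q):\mathbb Q\in\mathcal P,\ m(\mathbb Q)\le x\}$ and $d_{\sf L}(\mathbb P,x)=\inf\{D_{\sf KL}(\mathbb P\|\mathbb Q):\mathbb Q\in\mathcal P,\ m(\mathbb Q)\ge x\}$, where $m(\mathbb Q)$ is the mean of $\mathbb Q$. **Bandit.** Let $K\ge2$. Arm $i\in[K]$ has law $\mathbb P_i=\mathbb P_{j_i,\mu(i)}\in\mathcal P$ with mean $\mu(i)$ and likelihood $\pi_i=\pi_{j_i}$. In round $t\ge1$ an arm $A_t$ is chosen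 and a reward $X_t$ is observed which, conditionally on $A_1,X_1,\dots,A_{t-1},X_{t-1},A_t$, has law $\mathbb P_{A_t}$. Let $T_t(i)=\#\{s\le t:A_s=i\}$, and for every arm $i$ with $T_t(i)\ge1$ let $\mu_t(i)$ be the maximum likelihood estimate (MLE), a maximizer over $\mu\in\Theta$ of $\sum_{s\le t:\,A_s=i}\log\pi_i(X_s\mid\mu)$. (The value of $\mu_t(i)$ for an arm not yet sampled is arbitrary.) Write $\mathbb P_{t,i}=\mathbb P_{j_i,\mu_t(i)}$. **Sampling rules.** Let $\mathcal U_t=\{i:T_t(i)\le\lceil\sqrt{t/K}\rceil\}$. If $\mathcal U_t\ne\emptyset$, both rules choose $A_{t+1}\in\arg\min_{i\in\mathcal U_t}T_t(i)$ (forced exploration). If $\mathcal U_t=\emptyset$, let $a=a_t^{\sf top}\in\arg\max_i\mu_t(i)$, and for a weight vector $w$ and $i\ne a$ let $$G_{t,i}(w)=\inf_{x\in[\mu_t(i),\mu_t(a)]}\{w_a\,d_{\sf U}(\mathbb P_{t,a},x)+w_i\,d_{\sf L}(\mathbb P_{t,i},x)\}.$$ Let $w_t(i)$ be the vector with entries $w_{t,l}(i)=(T_t(l)+\mathbf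 1\{l=i\})/(t+1)$. * TCB: let $\Gamma_t(w)=\min_{i\ne a}G_{t,i}(w)$ and $b\in\arg\min_{i\ne a}G_{t,i}(T_t/t)$. Then $A_{t+1}=b$ if $\Gamma_t(w_t(b))>\Gamma_t(w_t(a))$, and $A_{t+1}=a$ if $\Gamma_t(w_t(b))<\Gamma_t(w_t(a))$. * ITCB: let $\Phi_t(w)=\min_{i\ne a}\{G_{t,i}(w)+\frac{\log((t+1)w_i)}{t+1}\}$ and $b\in\arg\min_{i\ne a}\{G_{t,i}(T_t/t)+\frac{\log T_t(i)}{t}\}$. Then $A_{t+1}=b$ if $\Phi_t(w_t(b))>\Phi_t(w_t(a))$, and $A_{t+1}=a$ if $\Phi_t(w_t(b))<\Phi_t(w_t(a))$. In case of equality $A_{t+1}$ is either of $a,b$; all ties are broken arbitrarily, and sampling is continued without stopping. **Conclusion.** Under the TCB rule, and likewise under the ITCB rule, almost surely $T_t(i)\ge\sqrt{t/K}-1$ for all $t$ and all arms $i$; and for every $\epsilon>0$ the random time $$N^\epsilon_{\nu}=\inf\{t\in\mathbb N:\ |\mu_s(i)-\mu(i)|<\epsilon\ \text{ for all } i\in[K]\text{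 and all } s\ge t\}$$ satisfies $\mathbb E_{\nu}[N^\epsilon_{\nu}]<+\infty$. -/

import Mathlib

open MeasureTheory Set
open scoped ENNReal

noncomputable section

/-- The mean `m(P) = E_P[X]`. -/
def mean (P : Measure ℝ) : ℝ := ∫ x, x ∂P

/-- The `L¹` Wasserstein distance on the real line, as an infimum over couplings. -/
def wasserstein1 (P Q : Measure ℝ) : ℝ≥0∞ :=
  ⨅ (γ : Measure (ℝ × ℝ)) (_ : γ.map Prod.fst = P ∧ γ.map Prod.snd = Q),
    ∫⁻ z, edist z.1 z.2 ∂γ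

/-- The data of a class of reward distributions parameterized by their means: a sample space `Ω`,
a parameter space `Θ`, a reference measure `ρ`, and likelihood functions `x ↦ π_j(x | θ)`,
written `lik j θ x`, which are densities with respect to `ρ`. The index `j` allows different arms
to have different likelihood functions (for example Gaussians with different known variances). -/
structure RewardModel (J : Type*) where
  Ω : Set ℝ
  Θ : Set ℝ
  ρ : Measure ℝ
  lik : J → ℝ → ℝ → ℝ

namespace RewardModel

variable {J : Type*} (M : RewardModel J)

/-- The distribution with likelihood `π_j(· | θ)`. -/
def law (j : J) (θ : ℝ) : Measure ℝ :=
  M.ρ.withDensity fun x => ENNReal.ofReal (M.lik j θ x)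

/-- The class of admissible reward distributions. -/
def laws : Set (Measure ℝ) := {P | ∃ j, ∃ θ ∈ M.Θ, P = M.law j θ}

/-- The log-likelihood `log π_j(x | θ)`. -/
def logLik (j : J) (x θ : ℝ) : ℝ := Real.log (M.lik j θ x)

/-- The score `∂ log π_j(x | θ) / ∂θ` (one-sided at the end points of `Θ`). -/
def score (j : J) (x θ : ℝ) : ℝ := derivWithin (M.logLik j x) M.Θ θ

/-- The standing assumptions on the stochastic model. -/
structure Regular : Prop where
  measurableSet_Ω : MeasurableSet M.Ω
  sigmaFinite : SigmaFinite M.ρ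
  measure_compl_Ω : M.ρ M.Ωᶜ = 0
  /-- The parameter space is a compact interval. -/
  isCompact_Θ : IsCompact M.Θ
  ordConnected_Θ : M.Θ.OrdConnected
  measurable_lik : ∀ j, ∀ θ ∈ M.Θ, Measurable (M.lik j θ)
  /-- The distributions are probability measures, parameterized by their means. -/
  isProbabilityMeasure : ∀ j, ∀ θ ∈ M.Θ, IsProbabilityMeasure (M.law j θ)
  integrable_id : ∀ j, ∀ θ ∈ M.Θ, Integrable (fun x => x) (M.law j θ)
  mean_law : ∀ j, ∀ θ ∈ M.Θ, mean (M.law j θ) = θ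
  /-- All distributions have the same support `Ω`. -/
  lik_pos : ∀ j, ∀ θ ∈ M.Θ, ∀ x ∈ M.Ω, 0 < M.lik j θ x
  /-- The likelihoods are differentiable (in particular continuous) in the mean, and the
  log-likelihoods are twice differentiable. -/
  differentiableOn_lik : ∀ j, ∀ x ∈ M.Ω, DifferentiableOn ℝ (fun θ => M.lik j θ x) M.Θ
  differentiableOn_score : ∀ j, ∀ x ∈ M.Ω, DifferentiableOn ℝ (M.score j x) M.Θ
  /-- The second derivative of the log-likelihood is bounded away from zero. -/
  curvature : ∃ σ : ℝ, 0 < σ ∧ ∀ j, ∀ x ∈ M.Ω, ∀ θ ∈ M.Θ,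
    derivWithin (M.score j x) M.Θ θ ≤ -σ ^ 2
  /-- The score is Lipschitz in the realization. -/
  score_lipschitz : ∃ c : ℝ, 0 < c ∧ ∀ j, ∀ x ∈ M.Ω, ∀ y ∈ M.Ω, ∀ θ ∈ M.Θ,
    |M.score j x θ - M.score j y θ| ≤ c * |x - y|
  /-- Log-likelihood ratios have a finite second moment. -/
  llr_sq_integrable : ∀ j, ∀ θ₀ ∈ M.Θ, ∀ θ ∈ M.Θ, ∀ θ' ∈ M.Θ,
    Integrable (fun x => |Real.log (M.lik j θ x / M.lik j θ' x)| ^ 2) (M.law j θ₀)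
  /-- The `L¹` transportation inequality, with one constant for the whole class. -/
  transport : ∃ c' : ℝ, 0 < c' ∧ ∀ P ∈ M.laws, ∀ Q : Measure ℝ, IsProbabilityMeasure Q →
    wasserstein1 P Q ≤ (ENNReal.ofReal (2 * c') * InformationTheory.klDiv Q P) ^ (1 / 2 : ℝ)

/-- `d_U(P, x)`: the least divergence from `P` to an admissible law of mean at most `x`. -/
def dU (P : Measure ℝ) (x : ℝ) : ℝ≥0∞ :=
  ⨅ Q ∈ M.laws, ⨅ (_ : mean Q ≤ x), InformationTheory.klDiv P Q

/-- `d_L(P, x)`: the least divergence from `P` to an admissible law of mean at least `x`. -/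
def dL (P : Measure ℝ) (x : ℝ) : ℝ≥0∞ :=
  ⨅ Q ∈ M.laws, ⨅ (_ : x ≤ mean Q), InformationTheory.klDiv P Q

end RewardModel

section Sampling

variable {K : ℕ}

/-! A path is given by the arms `a 0, a 1, …` and the rewards `x 0, x 1, …`, where `a s` and `x s`
belong to round `s + 1`. So "up to time `t`" means `s < t`, and `a t` is the arm chosen after
`t` rounds, that is `A_{t+1}`. -/

/-- `T_t(i)`, the number of times arm `i` is chosen in the first `t` rounds. -/
def pullCount (a : ℕ → Fin K) (t : ℕ) (i : Fin K) : ℕ :=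
  ((Finset.range t).filter fun s => a s = i).card

/-- The set `U_t` of under-explored arms. -/
def underExplored (a : ℕ → Fin K) (t : ℕ) : Set (Fin K) :=
  {i | pullCount a t i ≤ ⌈√((t : ℝ) / K)⌉₊}

/-- The allocation `w_t(i)` that results if arm `i` is selected in the next round. -/
def nextAlloc (a : ℕ → Fin K) (t : ℕ) (i l : Fin K) : ℝ :=
  ((pullCount a t l : ℝ) + if l = i then 1 else 0) / ((t : ℝ) + 1)

/-- The allocation `T_t / t`. -/
def currentAlloc (a : ℕ → Fin K) (t : ℕ) (l : Fin K) : ℝ := (pullCount a t l : ℝ) / t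

variable {J : Type*} (M : RewardModel J) (shape : Fin K → J)

/-- `m i` is the maximum likelihood estimate of the mean of arm `i` at time `t`, for each arm
that has been sampled (nothing is required of an arm without samples). -/
def IsMLE (a : ℕ → Fin K) (x : ℕ → ℝ) (t : ℕ) (m : Fin K → ℝ) : Prop :=
  ∀ i, 0 < pullCount a t i → m i ∈ M.Θ ∧ ∀ θ ∈ M.Θ,
    ∑ s ∈ (Finset.range t).filter (fun s => a s = i), M.logLik (shape i) (x s) θ ≤
      ∑ s ∈ (Finset.range t).filter (fun s => a s = i), M.logLik (shape i) (x s) (m i)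

/-- The least cost, over `x` in `[m i, m top]`, of
`w_top d_U(P_{t,top}, x) + w_i d_L(P_{t,i}, x)`, where `P_{t,l}` is the law of arm `l` at the
estimate `m l`. -/
def pairCost (m : Fin K → ℝ) (top i : Fin K) (w : Fin K → ℝ) : ℝ≥0∞ :=
  ⨅ x ∈ Icc (m i) (m top),
    (ENNReal.ofReal (w top) * M.dU (M.law (shape top) (m top)) x +
      ENNReal.ofReal (w i) * M.dL (M.law (shape i) (m i)) x)

/-- The minimum transportation cost `Γ_t(w)`. -/
def Gam (m : Fin K → ℝ) (top : Fin K) (w : Fin K → ℝ) : ℝ≥0∞ :=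
  ⨅ (i : Fin K) (_ : i ≠ top), pairCost M shape m top i w

/-- The minimum penalized transportation cost `Φ_t(w)`. -/
def Phi (t : ℕ) (m : Fin K → ℝ) (top : Fin K) (w : Fin K → ℝ) : EReal :=
  ⨅ (i : Fin K) (_ : i ≠ top), ((pairCost M shape m top i w : EReal) +
    ((Real.log (((t : ℝ) + 1) * w i) / ((t : ℝ) + 1) : ℝ) : EReal))

/-- Forced exploration: pick a least sampled arm of `U_t`. -/
def ForcedStep (a : ℕ → Fin K) (t : ℕ) : Prop :=
  a t ∈ underExplored a t ∧ ∀ i ∈ underExplored a t, pullCount a t (a t) ≤ pullCount a t i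

/-- The TCB rule at time `t`, given the estimates `m`. Ties are broken arbitrarily. -/
def TCBStep (a : ℕ → Fin K) (t : ℕ) (m : Fin K → ℝ) : Prop :=
  ((underExplored a t).Nonempty → ForcedStep a t) ∧
  (underExplored a t = ∅ →
    ∃ top, (∀ i, m i ≤ m top) ∧
    ∃ b, b ≠ top ∧
      (∀ i, i ≠ top → pairCost M shape m top b (currentAlloc a t) ≤
        pairCost M shape m top i (currentAlloc a t)) ∧
      ((a t = b ∧ Gam M shape m top (nextAlloc a t top) ≤ Gam M shape m top (nextAlloc a t b)) ∨
       (a t = top ∧ Gam M shape m top (nextAlloc a t b) ≤ Gam M shape m top (nextAlloc a t top))))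

/-- The ITCB rule at time `t`, given the estimates `m`. Ties are broken arbitrarily. -/
def ITCBStep (a : ℕ → Fin K) (t : ℕ) (m : Fin K → ℝ) : Prop :=
  ((underExplored a t).Nonempty → ForcedStep a t) ∧
  (underExplored a t = ∅ →
    ∃ top, (∀ i, m i ≤ m top) ∧
    ∃ b, b ≠ top ∧
      (∀ i, i ≠ top →
        (pairCost M shape m top b (currentAlloc a t) : EReal) +
            ((Real.log (pullCount a t b) / t : ℝ) : EReal) ≤
          (pairCost M shape m top i (currentAlloc a t) : EReal) +
            ((Real.log (pullCount a t i) / t : ℝ) : EReal)) ∧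
      ((a t = b ∧
          Phi M shape t m top (nextAlloc a t top) ≤ Phi M shape t m top (nextAlloc a t b)) ∨
       (a t = top ∧
          Phi M shape t m top (nextAlloc a t b) ≤ Phi M shape t m top (nextAlloc a t top))))

/-- `N^ε`: the first time from which on every estimate is within `ε` of the true mean
(infinite if there is no such time). -/
def convTime (μ : Fin K → ℝ) (ε : ℝ) (m : ℕ → Fin K → ℝ) : ℝ≥0∞ :=
  ⨅ (t : ℕ) (_ : 1 ≤ t ∧ ∀ s, t ≤ s → ∀ i, |m s i - μ i| < ε), (t : ℝ≥0∞)

/-- The information available when the reward of round `t + 1` is drawn: all arms and rewards of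
the first `t` rounds, and the arm chosen for round `t + 1`. -/
abbrev preRewardInfo {S : Type*} (A : ℕ → S → Fin K) (X : ℕ → S → ℝ) (t : ℕ) : MeasurableSpace S :=
  (⨆ s ∈ Set.Iio t, (MeasurableSpace.comap (A s) ⊤ ⊔ MeasurableSpace.comap (X s) inferInstance)) ⊔
    MeasurableSpace.comap (A t) ⊤

/-- Interaction with the bandit whose arm `i` has law `P i`: given the past and the chosen arm,
the next reward is drawn from the law of that arm. -/
structure IsBanditProcess {S : Type*} [MeasurableSpace S] (Pr : Measure S) (P : Fin K → Measure ℝ)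
    (A : ℕ → S → Fin K) (X : ℕ → S → ℝ) : Prop where
  measurable_arm : ∀ t, Measurable (A t)
  measurable_reward : ∀ t, Measurable (X t)
  reward_law : ∀ t, ∀ B : Set ℝ, MeasurableSet B →
    Pr[(X t ⁻¹' B).indicator (fun _ => (1 : ℝ)) | preRewardInfo A X t]
      =ᵐ[Pr] fun ω => (P (A t ω)).real B

end Sampling

end

/-! Both rules share forced exploration, which gives the deterministic count bound `√(t/K) - 1`
(`le_pullCount_of_forced`). What remains is a Chernoff bound for the MLE at the end of an adaptive
sample. The log-likelihood of each arm is concave. So if the MLE lies at or beyond `θ' = μ ± ε`, the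
sample is at least as likely under `θ'` as under `μ`, and the product of the square roots of the
likelihood ratios is at least 1. Under the true law each factor has mean the Bhattacharyya
coefficient, which is below 1 because distinct parameters have distinct means. Take `β` in (0, 1) at
least this coefficient. Dividing each factor by `β` leaves a nonnegative supermartingale
(`lintegral_prod_le_one`), and Markov's inequality bounds the deviation probability by `2 β ^
(√(t/K) - 1)` (`exists_measure_deviation_le`). The convergence time is at most 1 plus the sum of `t
+ 1` over the bad times `t`, so its mean is bounded by a convergent series. -/

/-! ### Forced exploration -/

section Exploration

variable {K : ℕ}

lemma pullCount_succ (a : ℕ → Fin K) (t : ℕ) (i : Fin K) :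
    pullCount a (t + 1) i = pullCount a t i + if a t = i then 1 else 0 := by
  unfold pullCount
  rw [Finset.range_add_one, Finset.filter_insert]
  split_ifs with h
  · rw [Finset.card_insert_of_notMem (by simp)]
  · simp

lemma pullCount_mono (a : ℕ → Fin K) (i : Fin K) : Monotone fun t => pullCount a t i :=
  monotone_nat_of_le_succ fun t => by rw [pullCount_succ]; exact Nat.le_add_right _ _

lemma lt_ceil_sqrt_div {t n : ℕ} (hK : 0 < K) (h : K * n ^ 2 < t) :
    n < ⌈√((t : ℝ) / K)⌉₊ := by
  rw [Nat.lt_ceil]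
  apply Real.lt_sqrt_of_sq_lt
  rw [lt_div_iff₀ (by exact_mod_cast hK), mul_comm]
  exact_mod_cast h

/-- Under forced exploration, the total shortage of samples below a level `n + 1` that is at most
the exploration threshold decreases in every round. -/
lemma deficit_succ_le {a : ℕ → Fin K} (hK : 0 < K)
    (ha : ∀ t, (underExplored a t).Nonempty → ForcedStep a t) {n t : ℕ} (h : K * n ^ 2 < t) :
    ∑ i, (n + 1 - pullCount a (t + 1) i) ≤ ∑ i, (n + 1 - pullCount a t i) - 1 := by
  by_cases h0 : ∀ i, n + 1 ≤ pullCount a t i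
  · have : ∑ i, (n + 1 - pullCount a (t + 1) i) = 0 := by
      apply Finset.sum_eq_zero
      intro i _
      have := pullCount_mono a i (Nat.le_succ t)
      have := h0 i
      simp only [Nat.succ_eq_add_one] at *
      omega
    omega
  · push Not at h0
    obtain ⟨i, hi⟩ := h0
    have hU : i ∈ underExplored a t := by
      have := lt_ceil_sqrt_div hK h
      simp only [underExplored, mem_ofPred_eq]
      omega
    have hs := (ha t ⟨i, hU⟩).2 i hU
    apply Nat.le_sub_one_of_lt
    apply Finset.sum_lt_sum
    · intro l _
      rw [pullCount_succ]
      omega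
    · refine ⟨a t, Finset.mem_univ _, ?_⟩
      rw [pullCount_succ, if_pos rfl]
      omega

/-- Once every arm has `n` samples, the total shortage below `n + 1` is at most `K`. It shrinks by
one per round, so `K` further rounds remove it. -/
lemma le_pullCount_of_forced {a : ℕ → Fin K} (hK : 0 < K)
    (ha : ∀ t, (underExplored a t).Nonempty → ForcedStep a t) (n : ℕ) :
    ∀ t, K * n ^ 2 < t → ∀ i, n ≤ pullCount a t i := by
  induction n with
  | zero => intros; exact Nat.zero_le _
  | succ n ih =>
    have key : ∀ j, ∑ i, (n + 1 - pullCount a (K * n ^ 2 + 1 + j) i) ≤ K - j := by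
      intro j
      induction j with
      | zero =>
        calc ∑ i, (n + 1 - pullCount a (K * n ^ 2 + 1 + 0) i) ≤ ∑ _i : Fin K, 1 := by
              apply Finset.sum_le_sum
              intro i _
              have := ih (K * n ^ 2 + 1 + 0) (by omega) i
              omega
          _ = K - 0 := by simp
      | succ j hj =>
        have := deficit_succ_le hK ha (n := n) (t := K * n ^ 2 + 1 + j) (by omega)
        rw [← add_assoc]
        omega
    intro t ht i
    have h1 : pullCount a (K * n ^ 2 + 1 + K) i ≤ pullCount a t i := by
      apply pullCount_mono a i
      -- `K (n + 1)² = K n² + 2 K n + K`, so the `K` extra rounds fit before time `t`.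
      nlinarith [Nat.zero_le (K * n)]
    have h2 : n + 1 - pullCount a (K * n ^ 2 + 1 + K) i = 0 := by
      have := key K
      rw [Nat.sub_self, Nat.le_zero, Finset.sum_eq_zero_iff] at this
      exact this i (Finset.mem_univ _)
    omega

lemma sqrt_sub_one_le_pullCount {a : ℕ → Fin K} (hK : 0 < K)
    (ha : ∀ t, (underExplored a t).Nonempty → ForcedStep a t) (t : ℕ) (i : Fin K) :
    √((t : ℝ) / K) - 1 ≤ pullCount a t i := by
  have hle := Nat.le_ceil (√((t : ℝ) / K))
  rcases Nat.eq_zero_or_pos ⌈√((t : ℝ) / K)⌉₊ with h0 | hpos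
  · rw [h0] at hle
    push_cast at hle
    linarith [Nat.cast_nonneg (α := ℝ) (pullCount a t i)]
  -- With `n + 1` the ceiling, `n` lies strictly below the root, as `K n² < t` demands, and the root
  -- is at most `n + 1`.
  · obtain ⟨n, hn⟩ := Nat.exists_eq_add_of_lt hpos
    rw [zero_add] at hn
    have hlt : (n : ℝ) < √((t : ℝ) / K) := Nat.lt_ceil.1 (by omega)
    rw [Real.lt_sqrt (Nat.cast_nonneg _), lt_div_iff₀ (by exact_mod_cast hK), mul_comm] at hlt
    have := le_pullCount_of_forced hK ha n t (by exact_mod_cast hlt) i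
    rw [hn] at hle
    push_cast at hle
    have : (n : ℝ) ≤ pullCount a t i := by exact_mod_cast this
    linarith

end Exploration

/-! ### Concavity of the log-likelihood and the Bhattacharyya coefficient -/

namespace RewardModel

variable {J : Type*} {M : RewardModel J}

/-- The curvature bound makes the score decreasing. One-sided derivatives agree with ordinary ones
in the interior of `Θ`, and continuity covers the end points. -/
lemma Regular.concaveOn_logLik (hM : M.Regular) (j : J) {x : ℝ} (hx : x ∈ M.Ω) :
    ConcaveOn ℝ M.Θ (M.logLik j x) := by
  have hconv : Convex ℝ M.Θ := hM.ordConnected_Θ.convex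
  have hdiff : DifferentiableOn ℝ (M.logLik j x) M.Θ :=
    (hM.differentiableOn_lik j x hx).log fun θ hθ => (hM.lik_pos j θ hθ x hx).ne'
  have hscore := hM.differentiableOn_score j x hx
  obtain ⟨σ, -, hσ⟩ := hM.curvature
  have hanti : AntitoneOn (M.score j x) (interior M.Θ) := by
    refine (antitoneOn_of_deriv_nonpos hconv hscore.continuousOn (hscore.mono interior_subset)
      fun θ hθ => ?_).mono interior_subset
    rw [← derivWithin_of_mem_nhds (mem_interior_iff_mem_nhds.1 hθ)]
    exact (hσ j x hx θ (interior_subset hθ)).trans (neg_nonpos.2 (sq_nonneg σ))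
  refine AntitoneOn.concaveOn_of_deriv hconv hdiff.continuousOn (hdiff.mono interior_subset) ?_
  refine hanti.congr fun θ hθ => ?_
  exact derivWithin_of_mem_nhds (mem_interior_iff_mem_nhds.1 hθ)

variable (M) in
/-- The square root of the likelihood ratio of `θ'` and `θ`. -/
noncomputable def sqrtRatio (j : J) (θ θ' x : ℝ) : ℝ :=
  Real.exp ((M.logLik j x θ' - M.logLik j x θ) / 2)

lemma Regular.measurable_sqrtRatio (hM : M.Regular) (j : J) {θ θ' : ℝ} (hθ : θ ∈ M.Θ)
    (hθ' : θ' ∈ M.Θ) : Measurable (M.sqrtRatio j θ θ') := by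
  have h1 := hM.measurable_lik j θ hθ
  have h2 := hM.measurable_lik j θ' hθ'
  unfold sqrtRatio logLik
  fun_prop

lemma Regular.lik_mul_sqrtRatio_sq (hM : M.Regular) (j : J) {θ θ' x : ℝ} (hθ : θ ∈ M.Θ)
    (hθ' : θ' ∈ M.Θ) (hx : x ∈ M.Ω) :
    M.lik j θ x * M.sqrtRatio j θ θ' x ^ 2 = M.lik j θ' x := by
  have h1 := hM.lik_pos j θ hθ x hx
  have h2 := hM.lik_pos j θ' hθ' x hx
  rw [sqrtRatio, ← Real.exp_nat_mul]
  push_cast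
  rw [mul_div_cancel₀ _ two_ne_zero, Real.exp_sub, logLik, logLik, Real.exp_log h1,
    Real.exp_log h2, mul_div_cancel₀ _ h1.ne']

lemma Regular.ae_mem_Ω (hM : M.Regular) : ∀ᵐ x ∂M.ρ, x ∈ M.Ω := hM.measure_compl_Ω

lemma Regular.law_compl_Ω (hM : M.Regular) (j : J) (θ : ℝ) : M.law j θ M.Ωᶜ = 0 :=
  withDensity_absolutelyContinuous _ _ hM.measure_compl_Ω

lemma Regular.withDensity_sqrtRatio_sq (hM : M.Regular) (j : J) {θ θ' : ℝ} (hθ : θ ∈ M.Θ)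
    (hθ' : θ' ∈ M.Θ) :
    (M.law j θ).withDensity (fun x => ENNReal.ofReal (M.sqrtRatio j θ θ' x ^ 2)) =
      M.law j θ' := by
  have h1 := (hM.measurable_lik j θ hθ).ennreal_ofReal
  have h2 := ((hM.measurable_sqrtRatio j hθ hθ').pow_const 2).ennreal_ofReal
  rw [law, law, ← withDensity_mul _ h1 h2]
  apply withDensity_congr_ae
  filter_upwards [hM.ae_mem_Ω] with x hx
  rw [Pi.mul_apply, ← ENNReal.ofReal_mul (hM.lik_pos j θ hθ x hx).le,
    hM.lik_mul_sqrtRatio_sq j hθ hθ' hx]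

/-- The Bhattacharyya coefficient of two distinct laws of the model is less than one. -/
lemma Regular.lintegral_sqrtRatio_lt_one (hM : M.Regular) (j : J) {θ θ' : ℝ} (hθ : θ ∈ M.Θ)
    (hθ' : θ' ∈ M.Θ) (hne : θ' ≠ θ) :
    ∫⁻ x, ENNReal.ofReal (M.sqrtRatio j θ θ' x) ∂M.law j θ < 1 := by
  have := hM.isProbabilityMeasure j θ hθ
  have := hM.isProbabilityMeasure j θ' hθ'
  have hmeas := hM.measurable_sqrtRatio j hθ hθ'
  set g := M.sqrtRatio j θ θ' with hg
  have hg0 : ∀ x, 0 < g x := fun x => Real.exp_pos _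
  have hsq : ∫⁻ x, ENNReal.ofReal (g x ^ 2) ∂M.law j θ = 1 := by
    have h := congrArg (fun ν : Measure ℝ => ν univ) (hM.withDensity_sqrtRatio_sq j hθ hθ')
    simpa [withDensity_apply] using h
  -- This integrates `2g + (g - 1)² = g² + 1`, arranged to avoid subtraction in `ℝ≥0∞`.
  have hsum : 2 * ∫⁻ x, ENNReal.ofReal (g x) ∂M.law j θ +
      ∫⁻ x, ENNReal.ofReal ((g x - 1) ^ 2) ∂M.law j θ = 2 := by
    rw [← lintegral_const_mul _ hmeas.ennreal_ofReal,
      ← lintegral_add_left (hmeas.ennreal_ofReal.const_mul 2)]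
    calc _ = ∫⁻ x, (ENNReal.ofReal (g x ^ 2) + 1) ∂M.law j θ := by
          refine lintegral_congr fun x => ?_
          rw [← ENNReal.ofReal_ofNat, ← ENNReal.ofReal_one, ← ENNReal.ofReal_mul two_pos.le,
            ← ENNReal.ofReal_add (mul_nonneg two_pos.le (hg0 x).le) (sq_nonneg _),
            ← ENNReal.ofReal_add (sq_nonneg _) one_pos.le]
          congr 1
          ring
      _ = 2 := by
          rw [lintegral_add_right _ measurable_const, hsq]
          simp [one_add_one_eq_two]
  -- A coefficient of at least 1 forces `∫ (g - 1)² = 0`, hence `g = 1` almost everywhere. Then the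
  -- two laws coincide, and so do their means `θ` and `θ'`.
  by_contra! hge
  have hzero : ∫⁻ x, ENNReal.ofReal ((g x - 1) ^ 2) ∂M.law j θ = 0 := by
    have h2 : (2 : ℝ≥0∞) ≤ 2 * ∫⁻ x, ENNReal.ofReal (g x) ∂M.law j θ :=
      le_mul_of_one_le_right' hge
    have h3 : (2 : ℝ≥0∞) + ∫⁻ x, ENNReal.ofReal ((g x - 1) ^ 2) ∂M.law j θ ≤ 2 + 0 := by
      rw [add_zero]
      exact (add_le_add_left h2 _).trans hsum.le
    exact le_antisymm ((ENNReal.add_le_add_iff_left (by simp)).1 h3) zero_le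
  rw [lintegral_eq_zero_iff (by fun_prop)] at hzero
  have hone : (fun x => ENNReal.ofReal (g x ^ 2)) =ᵐ[M.law j θ] 1 := by
    filter_upwards [hzero] with x hx
    have h1 : g x = 1 := by
      rw [Pi.zero_apply, ENNReal.ofReal_eq_zero] at hx
      have : g x - 1 = 0 := pow_eq_zero_iff two_ne_zero |>.1 (le_antisymm hx (sq_nonneg _))
      linarith
    simp [h1]
  have hlaw : M.law j θ' = M.law j θ := by
    rw [← hM.withDensity_sqrtRatio_sq j hθ hθ', ← hg, withDensity_congr_ae hone, withDensity_one]
  apply hne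
  rw [← hM.mean_law j θ' hθ', hlaw, hM.mean_law j θ hθ]

end RewardModel

/-! ### Rewards given the past -/

section BanditReward

variable {K : ℕ} {S : Type*} {A : ℕ → S → Fin K} {X : ℕ → S → ℝ}

lemma measurable_preRewardInfo_arm (t : ℕ) : Measurable[preRewardInfo A X t] (A t) :=
  (comap_measurable (A t)).mono le_sup_right le_rfl

lemma measurable_preRewardInfo_past_arm {s t : ℕ} (h : s < t) :
    Measurable[preRewardInfo A X t] (A s) :=
  (comap_measurable (A s)).mono
    (le_sup_of_le_left (le_iSup₂_of_le s h le_sup_left)) le_rfl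

lemma measurable_preRewardInfo_past_reward {s t : ℕ} (h : s < t) :
    Measurable[preRewardInfo A X t] (X s) :=
  (comap_measurable (X s)).mono
    (le_sup_of_le_left (le_iSup₂_of_le s h le_sup_right)) le_rfl

namespace IsBanditProcess

variable [mS : MeasurableSpace S] {Pr : Measure S} {P : Fin K → Measure ℝ}

lemma preRewardInfo_le (h : IsBanditProcess Pr P A X) (t : ℕ) : preRewardInfo A X t ≤ mS := by
  refine sup_le (iSup₂_le fun s _ => sup_le ?_ ?_) ?_
  · exact (h.measurable_arm s).comap_le
  · exact (h.measurable_reward s).comap_le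
  · exact (h.measurable_arm t).comap_le

variable [IsProbabilityMeasure Pr] [∀ i, IsProbabilityMeasure (P i)]

lemma measure_inter_preimage (h : IsBanditProcess Pr P A X) (t : ℕ) (i : Fin K) {E : Set S}
    (hE : MeasurableSet[preRewardInfo A X t] E) (hEi : ∀ ω ∈ E, A t ω = i) {B : Set ℝ}
    (hB : MeasurableSet B) : Pr (E ∩ X t ⁻¹' B) = Pr E * P i B := by
  have hm := h.preRewardInfo_le t
  have hXB : MeasurableSet (X t ⁻¹' B) := h.measurable_reward t hB
  have h1 := setIntegral_condExp hm (f := (X t ⁻¹' B).indicator fun _ => (1 : ℝ))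
    ((integrable_const (μ := Pr) (1 : ℝ)).indicator hXB) hE
  have h2 : ∫ ω in E, (Pr[(X t ⁻¹' B).indicator (fun _ => (1 : ℝ)) | preRewardInfo A X t]) ω ∂Pr =
      Pr.real E * (P i).real B := by
    rw [setIntegral_congr_ae (g := fun _ => (P i).real B) (hm _ hE)]
    · simp
    · filter_upwards [h.reward_law t B hB] with ω hω hωE
      rw [hω, hEi ω hωE]
  rw [h2, setIntegral_indicator hXB] at h1
  simp only [integral_const, smul_eq_mul, mul_one, measureReal_restrict_apply MeasurableSet.univ,
    univ_inter] at h1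
  rw [← ENNReal.toReal_eq_toReal_iff' (by finiteness) (by finiteness), ENNReal.toReal_mul]
  exact h1.symm

/-- On the event that arm `i` is chosen, the reward is independent of the past, with the law of
arm `i`. -/
lemma setLIntegral_mul_comp_reward (h : IsBanditProcess Pr P A X) (t : ℕ) (i : Fin K)
    {F : S → ℝ≥0∞} (hF : Measurable[preRewardInfo A X t] F) {g : ℝ → ℝ≥0∞} (hg : Measurable g) :
    ∫⁻ ω in {ω | A t ω = i}, F ω * g (X t ω) ∂Pr =
      (∫⁻ ω in {ω | A t ω = i}, F ω ∂Pr) * ∫⁻ x, g x ∂P i := by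
  have hm := h.preRewardInfo_le t
  have hX := h.measurable_reward t
  have hgX : Measurable fun ω => g (X t ω) := hg.comp hX
  have hmul : ∀ {F : S → ℝ≥0∞}, Measurable F → Measurable fun ω => F ω * g (X t ω) :=
    fun hF => hF.mul hgX
  have hAi' : MeasurableSet[preRewardInfo A X t] {ω | A t ω = i} :=
    measurable_preRewardInfo_arm t (measurableSet_singleton i)
  have hAi := hm _ hAi'
  refine @Measurable.ennreal_induction S (preRewardInfo A X t)
    (fun F => ∫⁻ ω in {ω | A t ω = i}, F ω * g (X t ω) ∂Pr =
      (∫⁻ ω in {ω | A t ω = i}, F ω ∂Pr) * ∫⁻ x, g x ∂P i) ?_ ?_ ?_ F hF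
  · intro c E hE
    have hE' := hm _ hE
    -- For the indicator of a past event, the claim says that the reward, restricted to that event
    -- and to the choice of `i`, is distributed as a multiple of `P i`.
    have hmap : (Pr.restrict (E ∩ {ω | A t ω = i})).map (X t) =
        Pr (E ∩ {ω | A t ω = i}) • P i := by
      ext B hB
      rw [Measure.map_apply hX hB, Measure.restrict_apply (hX hB), inter_comm,
        h.measure_inter_preimage t i (MeasurableSet.inter hE hAi') (fun ω hω => hω.2) hB]
      simp
    have h1 : ∀ ω, E.indicator (fun _ => c) ω * g (X t ω) =
        E.indicator (fun ω => c * g (X t ω)) ω := fun ω => by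
      by_cases hω : ω ∈ E <;> simp [hω]
    simp_rw [h1]
    rw [lintegral_indicator hE', lintegral_indicator hE', Measure.restrict_restrict hE',
      lintegral_const_mul _ hgX, ← lintegral_map hg hX, hmap]
    simp [mul_assoc]
  · intro F G _ hF' hG' ihF ihG
    have hF := hF'.mono hm le_rfl
    have hG := hG'.mono hm le_rfl
    simp only [Pi.add_apply, add_mul]
    rw [lintegral_add_left (hmul hF), lintegral_add_left hF, ihF, ihG, add_mul]
  · intro f hf' hmono ih
    have hf := fun n => (hf' n).mono hm le_rfl
    simp_rw [ENNReal.iSup_mul]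
    rw [lintegral_iSup (fun n => hmul (hf n))
      (fun n k hnk ω => mul_le_mul_left (hmono hnk ω) _), lintegral_iSup hf hmono,
      ENNReal.iSup_mul]
    exact iSup_congr ih

/-- Supermartingale argument: given the past, the new factor has mean at most 1 if arm `i` is chosen
and equals 1 otherwise. The random number of pulls therefore causes no difficulty. -/
lemma lintegral_prod_le_one (h : IsBanditProcess Pr P A X) (i : Fin K) {g : ℝ → ℝ≥0∞}
    (hg : Measurable g) (hg1 : ∫⁻ x, g x ∂P i ≤ 1) (t : ℕ) :
    ∫⁻ ω, ∏ s ∈ Finset.range t, (if A s ω = i then g (X s ω) else 1) ∂Pr ≤ 1 := by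
  induction t with
  | zero => simp
  | succ t ih =>
    have hm := h.preRewardInfo_le t
    have hAi : MeasurableSet {ω | A t ω = i} := h.measurable_arm t (measurableSet_singleton i)
    set F : S → ℝ≥0∞ := fun ω => ∏ s ∈ Finset.range t, (if A s ω = i then g (X s ω) else 1)
    have hF : Measurable[preRewardInfo A X t] F := by
      refine Finset.measurable_fun_prod _ fun s hs => ?_
      have hs := Finset.mem_range.1 hs
      exact Measurable.ite (measurable_preRewardInfo_past_arm hs (measurableSet_singleton i))
        (hg.comp (measurable_preRewardInfo_past_reward hs)) measurable_const
    refine le_trans ?_ ih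
    simp_rw [Finset.prod_range_succ]
    rw [← lintegral_add_compl _ hAi, ← lintegral_add_compl F hAi]
    refine add_le_add ?_ ?_
    · calc _ = ∫⁻ ω in {ω | A t ω = i}, F ω * g (X t ω) ∂Pr :=
            setLIntegral_congr_fun hAi fun ω hω => by
              have : A t ω = i := hω
              simp [F, this]
        _ ≤ _ := by
            rw [h.setLIntegral_mul_comp_reward t i hF hg]
            exact mul_le_of_le_one_right' hg1
    · refine (setLIntegral_congr_fun hAi.compl fun ω hω => ?_).le
      have : ¬ A t ω = i := hω
      simp [F, this]

lemma ae_reward_mem (h : IsBanditProcess Pr P A X) {Ω : Set ℝ} (hΩ : MeasurableSet Ω)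
    (hP : ∀ i, P i Ωᶜ = 0) : ∀ᵐ ω ∂Pr, ∀ t, X t ω ∈ Ω := by
  rw [ae_all_iff]
  intro t
  have hAi : ∀ i, Pr ({ω | A t ω = i} ∩ X t ⁻¹' Ωᶜ) = 0 := fun i => by
    have hE : MeasurableSet[preRewardInfo A X t] {ω | A t ω = i} :=
      measurable_preRewardInfo_arm t (measurableSet_singleton i)
    rw [h.measure_inter_preimage t i hE (fun ω hω => hω) hΩ.compl, hP, mul_zero]
  refine measure_mono_null (fun ω hω => ?_) (measure_iUnion_null hAi)
  exact mem_iUnion.2 ⟨A t ω, rfl, hω⟩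

end IsBanditProcess

end BanditReward
-- Deviations of the maximum likelihood estimate
section MaximumLikelihood

variable {J : Type*} {M : RewardModel J} {K : ℕ} {shape : Fin K → J}

/-- If `θ'` lies between the true parameter `θ` and the maximum likelihood estimate, then the
samples are at least as likely under `θ'` as under `θ`. -/
lemma IsMLE.one_le_prod_sqrtRatio (hM : M.Regular) {a : ℕ → Fin K} {x : ℕ → ℝ} {t : ℕ}
    {m : Fin K → ℝ} (hm : IsMLE M shape a x t m) (hx : ∀ s, x s ∈ M.Ω) {i : Fin K}
    (hi : 0 < pullCount a t i) {θ θ' : ℝ} (hθ : θ ∈ M.Θ) (hθ' : θ' ∈ uIcc θ (m i)) :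
    1 ≤ ∏ s ∈ Finset.range t,
      (if a s = i then ENNReal.ofReal (M.sqrtRatio (shape i) θ θ' (x s)) else 1) := by
  obtain ⟨hmΘ, hmax⟩ := hm i hi
  set I := (Finset.range t).filter fun s => a s = i
  have hconc : ConcaveOn ℝ M.Θ (fun u => ∑ s ∈ I, M.logLik (shape i) (x s) u) := by
    refine ⟨hM.ordConnected_Θ.convex, fun u hu v hv p q hp hq hpq => ?_⟩
    simp only [Finset.smul_sum, ← Finset.sum_add_distrib]
    exact Finset.sum_le_sum fun s _ =>
      (hM.concaveOn_logLik (shape i) (hx s)).2 hu hv hp hq hpq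
  -- On a segment a concave function is at least the smaller of its end values; here that is the
  -- value at `θ`, as `m i` is a maximizer.
  have hle : ∑ s ∈ I, M.logLik (shape i) (x s) θ ≤ ∑ s ∈ I, M.logLik (shape i) (x s) θ' := by
    have h := hconc.min_le_of_mem_segment hθ hmΘ (segment_eq_uIcc θ (m i) ▸ hθ')
    rwa [min_eq_left (hmax θ hθ)] at h
  simp only [RewardModel.sqrtRatio]
  rw [← Finset.prod_filter, ← ENNReal.ofReal_prod_of_nonneg fun s _ => (Real.exp_pos _).le,
    ← ENNReal.ofReal_one]
  apply ENNReal.ofReal_le_ofReal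
  rw [← Real.exp_sum, Real.one_le_exp_iff, ← Finset.sum_div, Finset.sum_sub_distrib]
  linarith

variable {μ : Fin K → ℝ} {S : Type*} [MeasurableSpace S] {Pr : Measure S}
  [IsProbabilityMeasure Pr] {A : ℕ → S → Fin K} {X : ℕ → S → ℝ} {est : ℕ → S → Fin K → ℝ}

lemma exists_measure_mem_uIcc_le_of_mem (hM : M.Regular) (hμ : ∀ i, μ i ∈ M.Θ)
    (hAX : IsBanditProcess Pr (fun i => M.law (shape i) (μ i)) A X)
    (hest : ∀ᵐ ω ∂Pr, ∀ t, IsMLE M shape (fun s => A s ω) (fun s => X s ω) t (est t ω))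
    {r : ℕ → ℝ} (hr : ∀ᵐ ω ∂Pr, ∀ t i, r t ≤ pullCount (fun s => A s ω) t i)
    (i : Fin K) {θ' : ℝ} (hθ' : θ' ∈ M.Θ) (hne : θ' ≠ μ i) :
    ∃ β : ℝ, 0 < β ∧ β < 1 ∧ ∀ t,
      Pr {ω | 0 < pullCount (fun s => A s ω) t i ∧ θ' ∈ uIcc (μ i) (est t ω i)} ≤
        ENNReal.ofReal (β ^ r t) := by
  have (i : Fin K) : IsProbabilityMeasure (M.law (shape i) (μ i)) :=
    hM.isProbabilityMeasure _ _ (hμ i)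
  have hmeas := hM.measurable_sqrtRatio (shape i) (hμ i) hθ'
  have hlt := hM.lintegral_sqrtRatio_lt_one (shape i) (hμ i) hθ' hne
  set g : ℝ → ℝ≥0∞ := fun x => ENNReal.ofReal (M.sqrtRatio (shape i) (μ i) θ' x)
  have hg : Measurable g := hmeas.ennreal_ofReal
  -- The maximum with `1 / 2` only keeps `β` positive, so that it can be inverted.
  set β : ℝ := max (∫⁻ x, g x ∂M.law (shape i) (μ i)).toReal (1 / 2)
  have hβ0 : 0 < β := lt_max_of_lt_right (by norm_num)
  have hβ1 : β < 1 := max_lt (by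
    rw [← ENNReal.toReal_one]
    exact (ENNReal.toReal_lt_toReal hlt.ne_top ENNReal.one_ne_top).2 hlt) (by norm_num)
  refine ⟨β, hβ0, hβ1, fun t => ?_⟩
  set b := ENNReal.ofReal β
  have hb0 : b ≠ 0 := (ENNReal.ofReal_pos.2 hβ0).ne'
  have hgb : ∫⁻ x, g x * b⁻¹ ∂M.law (shape i) (μ i) ≤ 1 := by
    rw [lintegral_mul_const _ hg, ← div_eq_mul_inv]
    refine ENNReal.div_le_of_le_mul ?_
    rw [one_mul, ← ENNReal.ofReal_toReal hlt.ne_top]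
    exact ENNReal.ofReal_le_ofReal (le_max_left _ _)
  have hprod := hAX.lintegral_prod_le_one i (hg.mul_const b⁻¹) hgb t
  set c := ENNReal.ofReal (β ^ (-r t))
  have hsub : Pr {ω | 0 < pullCount (fun s => A s ω) t i ∧ θ' ∈ uIcc (μ i) (est t ω i)} ≤
      Pr {ω | c ≤ ∏ s ∈ Finset.range t, (if A s ω = i then g (X s ω) * b⁻¹ else 1)} := by
    refine measure_mono_ae ?_
    filter_upwards [hest, hr, hAX.ae_reward_mem hM.measurableSet_Ω
      (fun i => hM.law_compl_Ω _ _)] with ω h1 h2 h3 hω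
    have h4 := (h1 t).one_le_prod_sqrtRatio hM h3 hω.1 (hμ i) hω.2
    have h5 : ∏ s ∈ Finset.range t, (if A s ω = i then g (X s ω) * b⁻¹ else 1) =
        (∏ s ∈ Finset.range t, (if A s ω = i then g (X s ω) else 1)) *
          b⁻¹ ^ pullCount (fun s => A s ω) t i := by
      rw [← Finset.prod_filter, ← Finset.prod_filter, Finset.prod_mul_distrib,
        Finset.prod_const, pullCount]
    change c ≤ _
    rw [h5]
    refine le_mul_of_one_le_of_le h4 ?_
    rw [← ENNReal.ofReal_inv_of_pos hβ0, ← ENNReal.ofReal_pow (inv_pos.2 hβ0).le]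
    apply ENNReal.ofReal_le_ofReal
    rw [← Real.rpow_natCast, Real.inv_rpow hβ0.le, ← Real.rpow_neg hβ0.le]
    -- As `β < 1`, the random factor `β ^ (-T_t(i))` is at least the deterministic `β ^ (-r t)`,
    -- which serves as the Markov threshold.
    exact Real.rpow_le_rpow_of_exponent_ge hβ0 hβ1.le (neg_le_neg (h2 t i))
  have hmeasF : Measurable fun ω =>
      ∏ s ∈ Finset.range t, (if A s ω = i then g (X s ω) * b⁻¹ else 1) :=
    Finset.measurable_fun_prod _ fun s _ =>
      Measurable.ite (hAX.measurable_arm s (measurableSet_singleton i))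
        ((hg.comp (hAX.measurable_reward s)).mul_const _) measurable_const
  have hmarkov := (mul_meas_ge_le_lintegral (μ := Pr) hmeasF c).trans hprod
  refine hsub.trans ?_
  have hcinv : ENNReal.ofReal (β ^ r t) = c⁻¹ := by
    rw [← ENNReal.ofReal_inv_of_pos (Real.rpow_pos_of_pos hβ0 _), Real.rpow_neg hβ0.le, inv_inv]
  rw [hcinv, ENNReal.le_inv_iff_mul_le, mul_comm]
  exact hmarkov

lemma exists_measure_mem_uIcc_le (hM : M.Regular) (hμ : ∀ i, μ i ∈ M.Θ)
    (hAX : IsBanditProcess Pr (fun i => M.law (shape i) (μ i)) A X)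
    (hest : ∀ᵐ ω ∂Pr, ∀ t, IsMLE M shape (fun s => A s ω) (fun s => X s ω) t (est t ω))
    {r : ℕ → ℝ} (hr : ∀ᵐ ω ∂Pr, ∀ t i, r t ≤ pullCount (fun s => A s ω) t i)
    (i : Fin K) {θ' : ℝ} (hne : θ' ≠ μ i) :
    ∃ β : ℝ, 0 < β ∧ β < 1 ∧ ∀ t,
      Pr {ω | 0 < pullCount (fun s => A s ω) t i ∧ θ' ∈ uIcc (μ i) (est t ω i)} ≤
        ENNReal.ofReal (β ^ r t) := by
  by_cases hθ' : θ' ∈ M.Θ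
  · exact exists_measure_mem_uIcc_le_of_mem hM hμ hAX hest hr i hθ' hne
  · refine ⟨1 / 2, by norm_num, by norm_num, fun t => ?_⟩
    refine le_of_eq_of_le (measure_eq_zero_iff_ae_notMem.2 ?_) zero_le
    filter_upwards [hest] with ω hω h
    -- The true mean and the MLE both lie in the interval `Θ`, so no point outside it can separate
    -- them.
    exact hθ' (hM.ordConnected_Θ.uIcc_subset (hμ i) (hω t i h.1).1 h.2)

/-- The probability of a deviation of the maximum likelihood estimate is exponentially small in
a lower bound on the number of samples. -/
lemma exists_measure_deviation_le (hM : M.Regular) (hμ : ∀ i, μ i ∈ M.Θ)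
    (hAX : IsBanditProcess Pr (fun i => M.law (shape i) (μ i)) A X)
    (hest : ∀ᵐ ω ∂Pr, ∀ t, IsMLE M shape (fun s => A s ω) (fun s => X s ω) t (est t ω))
    {r : ℕ → ℝ} (hr : ∀ᵐ ω ∂Pr, ∀ t i, r t ≤ pullCount (fun s => A s ω) t i)
    (i : Fin K) {ε : ℝ} (hε : 0 < ε) :
    ∃ β : ℝ, 0 < β ∧ β < 1 ∧ ∀ t,
      Pr {ω | ε ≤ |est t ω i - μ i|} ≤ 2 * ENNReal.ofReal (β ^ r t) := by
  obtain ⟨β₁, h10, h11, h1⟩ := exists_measure_mem_uIcc_le hM hμ hAX hest hr i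
    (θ' := μ i + ε) (by linarith)
  obtain ⟨β₂, h20, h21, h2⟩ := exists_measure_mem_uIcc_le hM hμ hAX hest hr i
    (θ' := μ i - ε) (by linarith)
  have hβ0 : 0 < max β₁ β₂ := lt_max_of_lt_left h10
  have hβ1 : max β₁ β₂ < 1 := max_lt h11 h21
  refine ⟨max β₁ β₂, hβ0, hβ1, fun t => ?_⟩
  -- If `r t ≤ 0` the arm may be unsampled and its estimate arbitrary, but the bound is then at
  -- least 1. If `r t > 0` the arm has been sampled.
  rcases le_or_gt (r t) 0 with hrt | hrt
  · have : (1 : ℝ) ≤ max β₁ β₂ ^ r t :=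
      Real.one_le_rpow_of_pos_of_le_one_of_nonpos hβ0 hβ1.le hrt
    calc Pr {ω | ε ≤ |est t ω i - μ i|} ≤ 1 := prob_le_one
      _ ≤ ENNReal.ofReal (max β₁ β₂ ^ r t) := ENNReal.one_le_ofReal.2 this
      _ ≤ 2 * ENNReal.ofReal (max β₁ β₂ ^ r t) := le_mul_of_one_le_left' one_le_two
  · have hsub : Pr {ω | ε ≤ |est t ω i - μ i|} ≤
        Pr ({ω | 0 < pullCount (fun s => A s ω) t i ∧ μ i + ε ∈ uIcc (μ i) (est t ω i)} ∪
          {ω | 0 < pullCount (fun s => A s ω) t i ∧ μ i - ε ∈ uIcc (μ i) (est t ω i)}) := by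
      refine measure_mono_ae ?_
      filter_upwards [hr] with ω hω hdev
      have hpos : 0 < pullCount (fun s => A s ω) t i := by
        exact_mod_cast hrt.trans_le (hω t i)
      rcases le_abs.1 (show ε ≤ |est t ω i - μ i| from hdev) with h | h
      · exact Or.inl ⟨hpos, mem_uIcc.2 (Or.inl ⟨by linarith, by linarith⟩)⟩
      · exact Or.inr ⟨hpos, mem_uIcc.2 (Or.inr ⟨by linarith, by linarith⟩)⟩
    refine hsub.trans ((measure_union_le _ _).trans ?_)
    rw [two_mul]
    refine add_le_add ((h1 t).trans ?_) ((h2 t).trans ?_) <;> apply ENNReal.ofReal_le_ofReal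
    · exact Real.rpow_le_rpow h10.le (le_max_left _ _) hrt.le
    · exact Real.rpow_le_rpow h20.le (le_max_right _ _) hrt.le

end MaximumLikelihood

/-! ### Summability of the deviation bounds -/

lemma summable_succ_mul_rpow_sqrt {β c : ℝ} (hβ0 : 0 < β) (hβ1 : β < 1) (hc : 0 < c) :
    Summable fun t : ℕ => ((t : ℝ) + 1) * β ^ (√((t : ℝ) / c) - 1) := by
  have hl : 0 < -Real.log β := neg_pos.2 (Real.log_neg hβ0 hβ1)
  set l := -Real.log β
  have hsum : Summable fun t : ℕ => (2 * (720 * β⁻¹ * (c ^ 3 / l ^ 6))) * (1 / (t : ℝ) ^ 2) :=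
    (Real.summable_one_div_nat_pow.2 one_lt_two).mul_left _
  refine hsum.of_norm_bounded_eventually_nat ?_
  filter_upwards [Filter.eventually_ge_atTop 1] with t ht
  have ht1 : (1 : ℝ) ≤ t := by exact_mod_cast ht
  have ht0 : (0 : ℝ) < t := by linarith
  have hpow : 0 < β ^ (√((t : ℝ) / c) - 1) := Real.rpow_pos_of_pos hβ0 _
  rw [Real.norm_of_nonneg (by positivity)]
  set y := l * √((t : ℝ) / c)
  have hy : 0 < y := by positivity
  have hy6 : y ^ 6 = l ^ 6 * (t / c) ^ 3 := by
    rw [mul_pow, show 6 = 2 * 3 from rfl, pow_mul (√((t : ℝ) / c)), Real.sq_sqrt (by positivity)]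
  -- `720 = 6!`. Since `y ^ 6` is of order `t³`, the series is dominated by `1 / t²`; the fourth
  -- power would only give `1 / t`.
  have hexp : Real.exp (-y) ≤ 720 / y ^ 6 := by
    have h := Real.pow_div_factorial_le_exp y hy.le 6
    rw [Real.exp_neg, ← inv_div]
    refine inv_anti₀ (by positivity) ?_
    simpa [Nat.factorial] using h
  have heq : β ^ (√((t : ℝ) / c) - 1) = β⁻¹ * Real.exp (-y) := by
    rw [Real.rpow_sub hβ0, Real.rpow_one, Real.rpow_def_of_pos hβ0, div_eq_inv_mul]
    congr 2
    simp [y, l]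
  calc ((t : ℝ) + 1) * β ^ (√((t : ℝ) / c) - 1) ≤ (2 * t) * (β⁻¹ * (720 / y ^ 6)) := by
        rw [heq]
        gcongr
        linarith
    _ = (2 * (720 * β⁻¹ * (c ^ 3 / l ^ 6))) * (1 / (t : ℝ) ^ 2) := by
        rw [hy6]
        field_simp

/-! ### Expected convergence time -/

section ConvergenceTime

variable {K : ℕ}

/-- If the time exceeds 1, it is `n + 1` with `n` the last bad time, and the term of `n` alone is at
least `n + 1`. The leading 1 covers a time equal to 1. -/
lemma convTime_le_tsum (μ : Fin K → ℝ) (ε : ℝ) (m : ℕ → Fin K → ℝ) :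
    convTime μ ε m ≤
      1 + ∑' t : ℕ, ∑ i, {x : Fin K → ℝ | ε ≤ |x i - μ i|}.indicator
        (fun _ => (t : ℝ≥0∞) + 1) (m t) := by
  set f : ℕ → ℝ≥0∞ := fun t => ∑ i, {x : Fin K → ℝ | ε ≤ |x i - μ i|}.indicator
    (fun _ => (t : ℝ≥0∞) + 1) (m t)
  have hf : ∀ t, (¬ ∀ i, |m t i - μ i| < ε) → (t : ℝ≥0∞) + 1 ≤ f t := by
    intro t ht
    push Not at ht
    obtain ⟨i, hi⟩ := ht
    refine le_trans ?_ (Finset.single_le_sum (fun _ _ => zero_le) (Finset.mem_univ i))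
    rw [indicator_of_mem (by exact hi)]
  by_cases htop : ∑' t, f t = ∞
  · simp [htop]
  have hex : ∃ t, 1 ≤ t ∧ ∀ s, t ≤ s → ∀ i, |m s i - μ i| < ε := by
    -- Every bad time contributes at least 1, so a finite sum allows only finitely many.
    have h := (ENNReal.tendsto_atTop_zero_of_tsum_ne_top htop).eventually_lt_const
      (zero_lt_one (α := ℝ≥0∞))
    obtain ⟨N, hN⟩ := Filter.eventually_atTop.1 h
    refine ⟨N + 1, by omega, fun s hs => ?_⟩
    by_contra hbad
    exact absurd (hN s (by omega)) (not_lt.2 (le_add_self.trans (hf s hbad)))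
  classical
  obtain ⟨h1, hgood⟩ := Nat.find_spec hex
  have hmin := fun k => Nat.find_min hex (m := k)
  refine (iInf₂_le (Nat.find hex) ⟨h1, hgood⟩).trans ?_
  generalize Nat.find hex = N at *
  obtain ⟨n, rfl⟩ := Nat.exists_eq_add_of_le' h1
  rcases Nat.eq_zero_or_pos n with rfl | hn
  · simp
  · have hbad : ¬ ∀ i, |m n i - μ i| < ε := fun hn' => by
      refine hmin n (by omega) ⟨hn, fun s hs => ?_⟩
      rcases hs.eq_or_lt with rfl | hs
      · exact hn'
      · exact hgood s hs
    calc ((n + 1 : ℕ) : ℝ≥0∞) ≤ f n := by exact_mod_cast hf n hbad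
      _ ≤ ∑' t, f t := ENNReal.le_tsum n
      _ ≤ 1 + ∑' t, f t := le_add_self

variable {S : Type*} [MeasurableSpace S] {Pr : Measure S} [IsProbabilityMeasure Pr]

lemma lintegral_convTime_le (μ : Fin K → ℝ) (ε : ℝ) {m : ℕ → S → Fin K → ℝ}
    (hm : ∀ t, Measurable (m t)) :
    ∫⁻ ω, convTime μ ε (fun t => m t ω) ∂Pr ≤
      1 + ∑ i, ∑' t : ℕ, ((t : ℝ≥0∞) + 1) * Pr {ω | ε ≤ |m t ω i - μ i|} := by
  have hset : ∀ i, MeasurableSet {x : Fin K → ℝ | ε ≤ |x i - μ i|} := fun i =>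
    measurableSet_le measurable_const (by fun_prop)
  have hind : ∀ (t : ℕ) i, Measurable fun ω =>
      {x : Fin K → ℝ | ε ≤ |x i - μ i|}.indicator (fun _ => (t : ℝ≥0∞) + 1) (m t ω) :=
    fun t i => (measurable_const.indicator (hset i)).comp (hm t)
  -- Bounding pointwise first avoids any measurability question about `convTime`.
  refine (lintegral_mono fun ω => convTime_le_tsum μ ε fun t => m t ω).trans ?_
  rw [lintegral_add_left measurable_const,
    lintegral_tsum fun t => (Finset.measurable_fun_sum _ fun i _ => hind t i).aemeasurable,
    ← Summable.tsum_finsetSum fun i _ => ENNReal.summable]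
  refine add_le_add (by simp) (ENNReal.tsum_le_tsum fun t => ?_)
  rw [lintegral_finsetSum _ fun i _ => hind t i]
  refine Finset.sum_le_sum fun i _ => le_of_eq ?_
  exact lintegral_indicator_const (hm t (hset i)) _

end ConvergenceTime

/-! ### Conclusion -/

theorem mainTheorem2 {J : Type*} (M : RewardModel J) (hM : M.Regular)
    {K : ℕ} (hK : 2 ≤ K) (shape : Fin K → J) (μ : Fin K → ℝ) (hμ : ∀ i, μ i ∈ M.Θ)
    {S : Type*} [MeasurableSpace S] (Pr : Measure S) [IsProbabilityMeasure Pr]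
    (A : ℕ → S → Fin K) (X : ℕ → S → ℝ)
    (hAX : IsBanditProcess Pr (fun i => M.law (shape i) (μ i)) A X)
    (est : ℕ → S → Fin K → ℝ) (hest_meas : ∀ t, Measurable (est t))
    (hest : ∀ᵐ ω ∂Pr, ∀ t, IsMLE M shape (fun s => A s ω) (fun s => X s ω) t (est t ω))
    (hrule : (∀ᵐ ω ∂Pr, ∀ t, TCBStep M shape (fun s => A s ω) t (est t ω)) ∨
      (∀ᵐ ω ∂Pr, ∀ t, ITCBStep M shape (fun s => A s ω) t (est t ω))) :
    (∀ᵐ ω ∂Pr, ∀ (t : ℕ) (i : Fin K), √((t : ℝ) / K) - 1 ≤ pullCount (fun s => A s ω) t i) ∧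
    ∀ ε : ℝ, 0 < ε → ∫⁻ ω, convTime μ ε (fun t => est t ω) ∂Pr < ∞ := by

  have hK0 : 0 < K := by omega
  have hforced : ∀ᵐ ω ∂Pr, ∀ t, (underExplored (fun s => A s ω) t).Nonempty →
      ForcedStep (fun s => A s ω) t := by
    rcases hrule with h | h <;> filter_upwards [h] with ω hω t
    · exact (hω t).1
    · exact (hω t).1
  have hcount : ∀ᵐ ω ∂Pr, ∀ (t : ℕ) (i : Fin K),
      √((t : ℝ) / K) - 1 ≤ pullCount (fun s => A s ω) t i := by
    filter_upwards [hforced] with ω hω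
    exact sqrt_sub_one_le_pullCount hK0 hω
  refine ⟨hcount, fun ε hε => (lintegral_convTime_le μ ε hest_meas).trans_lt ?_⟩
  refine ENNReal.add_lt_top.2 ⟨ENNReal.one_lt_top, ENNReal.sum_lt_top.2 fun i _ => ?_⟩
  -- The lower bound on the counts is now `r t = √(t/K) - 1`.
  obtain ⟨β, hβ0, hβ1, hβ⟩ := exists_measure_deviation_le hM hμ hAX hest hcount i hε
  have hsum := summable_succ_mul_rpow_sqrt hβ0 hβ1 (c := K) (by exact_mod_cast hK0)
  calc ∑' t : ℕ, ((t : ℝ≥0∞) + 1) * Pr {ω | ε ≤ |est t ω i - μ i|} ≤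
      ∑' t : ℕ, 2 * ENNReal.ofReal (((t : ℝ) + 1) * β ^ (√((t : ℝ) / K) - 1)) := by
        refine ENNReal.tsum_le_tsum fun t => ?_
        rw [ENNReal.ofReal_mul (by positivity), ENNReal.ofReal_add t.cast_nonneg zero_le_one,
          ENNReal.ofReal_natCast, ENNReal.ofReal_one, mul_left_comm]
        gcongr
        exact hβ t
    _ < ∞ := by
        rw [ENNReal.tsum_mul_left]
        exact ENNReal.mul_lt_top (by simp) hsum.tsum_ofReal_lt_top
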